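/- The game of Cops and Robbers with $k$ cops on a finite graph $G$ is played in rounds: in round $0$ the cops choose their starting vertices (possibly with repetition) and then the robber chooses hers; in every later round first each cop and then the robber moves to an adjacent vertex or stays put, with full information. The robber is captured when some cop occupies the same vertex as she does. The cop number $c(G)$ is the least number of cops that have a strategy which always captures the robber after finitely many rounds. The $k$-capture time $\mathrm{capt}_k(G)$ is the least $T$ such that $k$ cops have a strategy which captures the robber in at most $T$ rounds (round $0$ not counted) however she plays, and $\mathrm{capt}_k(G)=\infty$ if there is no such $T$. Let $G^d_n$ be the $d$-dimensional Cartesian grid on $n^d$ vertices, that is, the Cartesian product of $d$ paths on $n$ vertices each. **Theorem.** Fix an integer $d\ge 1$ and let $k=k(n)$ be a sequence of non-negative integers with $k\ge c(G^d_n)$ for all sufficiently large $n$ and $k=O(n^d)$. Then, as $n\to\infty$, $\mathrm{capt}_k(G^d_n)$ is finite for all sufficiently large $n$ and $$\mathrm{capt}_k(G^d_n)=O\!\left(n/k^{1/d}\right).$$ If moreover $k<n^d$ for all sufficiently large $n$ (that is, there are fewer cops than vertices), then $$\mathrm{capt}_k(G^d_n)=\Theta\!\left(n/k^{1/d}\right).$$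 -/

import Mathlib

open Filter Asymptotics

namespace CopsRobbers

/-- The `d`-fold Cartesian (box) power of a graph: two `d`-tuples are adjacent if they are adjacent
in exactly one coordinate and equal in all the others. -/
def boxPower {V : Type*} (G : SimpleGraph V) (d : ℕ) : SimpleGraph (Fin d → V) where
  Adj x y := ∃ i, G.Adj (x i) (y i) ∧ ∀ j, j ≠ i → x j = y j
  symm := ⟨fun _ _ ⟨i, h, h'⟩ => ⟨i, h.symm, fun j hj => (h' j hj).symm⟩⟩
  loopless := ⟨fun _ ⟨_, h, _⟩ => h.ne rfl⟩

/-- The `d`-dimensional Cartesian grid on `n ^ d` vertices, the box product of `d` copies of the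
path on `n` vertices. -/
def grid (d n : ℕ) : SimpleGraph (Fin d → Fin n) :=
  boxPower (SimpleGraph.pathGraph n) d

variable {V : Type*}

/-- A legal move of a single player: along an edge, or staying put (all vertices carry loops). -/
def Move (G : SimpleGraph V) (u v : V) : Prop := u = v ∨ G.Adj u v

/-- A strategy for `k` cops (several of which may share a vertex).  `pos [r₀, …, rₜ₋₁]` lists the
positions of the cops after their move in round `t` when the robber has so far occupied the vertices
`r₀` (chosen in round `0`), …, `rₜ₋₁`; in particular `pos []` is the placement of the cops in
round `0`. -/
structure CopStrategy (G : SimpleGraph V) (k : ℕ) where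
  /-- the positions of the cops, given the past of the robber -/
  pos : List V → Fin k → V
  legal : ∀ (h : List V) (v : V) (i : Fin k), Move G (pos h i) (pos (h ++ [v]) i)

/-- A trajectory of the robber; `r t` is her position at the end of round `t`. -/
def IsRobberPlay (G : SimpleGraph V) (r : ℕ → V) : Prop := ∀ t, Move G (r t) (r (t + 1))

/-- The positions of the cops in round `t` when they follow `σ` against the trajectory `r`. -/
def CopStrategy.copsAt {G : SimpleGraph V} {k : ℕ} (σ : CopStrategy G k) (r : ℕ → V) (t : ℕ) :
    Fin k → V :=
  σ.pos ((List.range t).map r)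

/-- In round `t` a cop and the robber occupy the same vertex: either after the robber's move
(after her choice of a starting vertex if `t = 0`), or already after the cops' move, when the robber
is still at her position of the previous round. -/
def CopStrategy.CapturesInRound {G : SimpleGraph V} {k : ℕ} (σ : CopStrategy G k) (r : ℕ → V)
    (t : ℕ) : Prop :=
  (∃ i, σ.copsAt r t i = r t) ∨ ∃ s, t = s + 1 ∧ ∃ i, σ.copsAt r t i = r s

/-- `k` cops have a winning strategy on `G`. -/
def CopsWin (G : SimpleGraph V) (k : ℕ) : Prop :=
  ∃ σ : CopStrategy G k, ∀ r, IsRobberPlay G r → ∃ t, σ.CapturesInRound r t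

/-- `k` cops have a strategy on `G` that captures the robber in at most `T` rounds, round `0` not
being counted, however she plays. -/
def CopsWinWithin (G : SimpleGraph V) (k T : ℕ) : Prop :=
  ∃ σ : CopStrategy G k, ∀ r, IsRobberPlay G r → ∃ t, t ≤ T ∧ σ.CapturesInRound r t

/-- The cop number `c(G)`: the least number of cops that have a winning strategy. -/
noncomputable def copNumber (G : SimpleGraph V) : ℕ∞ :=
  ⨅ (k : ℕ) (_ : CopsWin G k), (k : ℕ∞)

/-- The `k`-capture time `capt_k(G)`: the least number of rounds within which `k` cops can guarantee
to capture the robber, and `∞` if there is none. -/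
noncomputable def captureTime (G : SimpleGraph V) (k : ℕ) : ℕ∞ :=
  ⨅ (T : ℕ) (_ : CopsWinWithin G k T), (T : ℕ∞)

end CopsRobbers

/-! Upper bound: `d / 2 + 1` cops catch the robber on a grid of side `s` in time linear in `s`
(`exists_catchesBy_grid`). One cop tries to differ from her in a single coordinate, each other cop
in two coordinates by equal amounts. Every cop keeps a potential of size `O(s)` from growing, and
every robber move, or pass, lowers the potential of a cop watching the coordinate concerned.

With more cops, cover the grid by `m ^ d` boxes of side about `n / m`, where `m` is of order `k ^ (1
/ d)`. A team in each box chases the robber's shadow under the retraction onto that box. After `O(n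
/ m)` rounds every shadow is caught, and in a box containing the robber the shadow is the robber
herself (`exists_catchesBy_of_boxes`). One such team is always available: fewer than `d / 2 + 1`
cops lose on large grids (`lt_two_mul_of_copsWin_grid`).

Lower bound: against a motionless robber, balls of radius `T` around the starting cops must cover
the grid (`pow_le_of_copsWinWithin`). -/

namespace CopsRobbers

/-! ### Reactive strategies and capture by potentials -/

section Strategies

variable {V : Type*} {G : SimpleGraph V} {k : ℕ}

lemma Move.refl (v : V) : Move G v v := Or.inl rfl

/-- A strategy in which every cop `i` reacts to the first position `v` of the robber by `first i v`
and, standing at `p`, to a move of the robber from `u` to `v` by `resp i p u v`. -/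
def reactiveStrategy (start : Fin k → V) (first : Fin k → V → V) (resp : Fin k → V → V → V → V)
    (hfirst : ∀ i v, Move G (start i) (first i v))
    (hresp : ∀ i p u v, Move G p (resp i p u v)) : CopStrategy G k where
  pos h i := (h.foldl (fun (s : V × Option V) v =>
    (s.2.elim (first i v) (fun u => resp i s.1 u v), some v)) (start i, none)).1
  legal h v i := by
    rw [List.foldl_append]
    -- The fold remembers the robber's last position, which is `none` only for the empty history.
    rcases List.eq_nil_or_concat h with rfl | ⟨l, u, rfl⟩
    · exact hfirst i v
    · simp only [List.concat_eq_append, List.foldl_append]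
      exact hresp i _ _ _

section

variable (start : Fin k → V) (first : Fin k → V → V) (resp : Fin k → V → V → V → V)
  (hfirst : ∀ i v, Move G (start i) (first i v)) (hresp : ∀ i p u v, Move G p (resp i p u v))

lemma reactiveStrategy_copsAt_add_two (r : ℕ → V) (t : ℕ) (i : Fin k) :
    (reactiveStrategy start first resp hfirst hresp).copsAt r (t + 2) i =
      resp i ((reactiveStrategy start first resp hfirst hresp).copsAt r (t + 1) i)
        (r t) (r (t + 1)) := by
  simp [CopStrategy.copsAt, reactiveStrategy, List.range_succ]

end

/-- The cops following `σ` are sure to have one of them on the last position of the robber after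
their move in round `T + 1`. -/
def CopStrategy.CatchesBy (σ : CopStrategy G k) (T : ℕ) : Prop :=
  ∀ r, IsRobberPlay G r → ∃ i, σ.copsAt r (T + 1) i = r T

lemma CopStrategy.CatchesBy.copsWinWithin {σ : CopStrategy G k} {T : ℕ} (h : σ.CatchesBy T) :
    CopsWinWithin G k (T + 1) :=
  ⟨σ, fun r hr => ⟨T + 1, le_rfl, Or.inr ⟨T, rfl, h r hr⟩⟩⟩

/-- Cops which can each keep a potential from increasing, such that each move of the robber
decreases one of these potentials, catch the robber. -/
theorem exists_catchesBy_of_potential (start : V) (Inv : Fin k → V → V → Prop)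
    (Act : Fin k → V → V → Prop) (Ψ : Fin k → V → V → ℕ) (B : ℕ)
    (hinit : ∀ i r, ∃ p, Move G start p ∧ Inv i p r)
    (hstep : ∀ i p r r', Move G r r' → Inv i p r → ∃ p', Move G p p' ∧
      (p' = r' ∨ Inv i p' r' ∧ Ψ i p' r' ≤ Ψ i p r ∧ (Act i r r' → Ψ i p' r' < Ψ i p r)))
    (hact : ∀ r r', Move G r r' → ∃ i, Act i r r')
    (hB : ∀ (p : Fin k → V) r, ∑ i, Ψ i (p i) r ≤ B) :
    ∃ σ : CopStrategy G k, σ.CatchesBy (B + 1) := by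
  classical
  choose first hfirst hfirstInv using hinit
  have hresp : ∀ i p r r', ∃ p', Move G p p' ∧ (Move G r r' → (p = r → p' = r') ∧
      (Inv i p r → (p' = r' ∨ Inv i p' r' ∧ Ψ i p' r' ≤ Ψ i p r ∧
        (Act i r r' → Ψ i p' r' < Ψ i p r)))) := by
    intro i p r r'
    by_cases hm : Move G r r'
    · by_cases hpr : p = r
      · subst hpr
        exact ⟨r', hm, fun _ => ⟨fun _ => rfl, fun _ => Or.inl rfl⟩⟩
      · by_cases hI : Inv i p r
        · obtain ⟨p', h1, h2⟩ := hstep i p r r' hm hI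
          exact ⟨p', h1, fun _ => ⟨fun h => absurd h hpr, fun _ => h2⟩⟩
        · exact ⟨p, Move.refl p, fun _ => ⟨fun h => absurd h hpr, fun h => absurd h hI⟩⟩
    · exact ⟨p, Move.refl p, fun h => absurd h hm⟩
  choose resp hmove hresp using hresp
  refine ⟨reactiveStrategy (fun _ => start) first resp hfirst hmove, fun r hr => ?_⟩
  set p := (reactiveStrategy (fun _ => start) first resp hfirst hmove).copsAt r with hp
  have hp1 : ∀ i, p 1 i = first i (r 0) := fun i => rfl
  have hp2 : ∀ t i, p (t + 2) i = resp i (p (t + 1) i) (r t) (r (t + 1)) := fun t i =>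
    reactiveStrategy_copsAt_add_two _ _ _ hfirst hmove r t i
  -- A cop who has caught the robber copies her moves. Capture thus persists, so that separate teams
  -- can be compared at one common time.
  have hkeep : ∀ t i, p (t + 1) i = r t → p (t + 2) i = r (t + 1) := fun t i h => by
    rw [hp2]
    exact (hresp i _ _ _ (hr t)).1 h
  have main : ∀ t, (∃ i, p (t + 1) i = r t) ∨
      (∀ i, Inv i (p (t + 1) i) (r t)) ∧ (∑ i, Ψ i (p (t + 1) i) (r t)) + t ≤ B := by
    intro t
    induction t with
    | zero => exact Or.inr ⟨fun i => hp1 i ▸ hfirstInv i (r 0), hB _ _⟩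
    | succ t ih =>
      by_cases hc' : ∃ i, p (t + 2) i = r (t + 1)
      · exact Or.inl hc'
      right
      push Not at hc'
      rcases ih with ⟨i, hi⟩ | ⟨hI, hS⟩
      · exact absurd (hkeep t i hi) (hc' i)
      have hst : ∀ i, Inv i (p (t + 2) i) (r (t + 1)) ∧
          Ψ i (p (t + 2) i) (r (t + 1)) ≤ Ψ i (p (t + 1) i) (r t) ∧
          (Act i (r t) (r (t + 1)) →
            Ψ i (p (t + 2) i) (r (t + 1)) < Ψ i (p (t + 1) i) (r t)) := by
        intro i
        have h := (hresp i (p (t + 1) i) _ _ (hr t)).2 (hI i)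
        rw [← hp2] at h
        exact h.resolve_left (hc' i)
      refine ⟨fun i => (hst i).1, ?_⟩
      obtain ⟨i, hi⟩ := hact _ _ (hr t)
      have := Finset.sum_lt_sum (s := Finset.univ) (fun i _ => (hst i).2.1)
        ⟨i, Finset.mem_univ i, (hst i).2.2 hi⟩
      change (∑ i, Ψ i (p (t + 2) i) (r (t + 1))) + (t + 1) ≤ B
      omega
  -- A sum of natural numbers plus `B + 1` cannot be at most `B`.
  exact (main (B + 1)).resolve_right fun h => by omega

end Strategies

/-! ### Coordinate distances on the grid -/

section Potential

variable {d n : ℕ}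

lemma move_grid_iff {r s : Fin d → Fin n} : Move (grid d n) r s ↔ r = s ∨
    ∃ i, ((r i : ℕ) + 1 = s i ∨ (s i : ℕ) + 1 = r i) ∧ ∀ j, j ≠ i → r j = s j := by
  simp [Move, grid, boxPower, SimpleGraph.pathGraph_adj]

/-- The distance of two natural numbers. -/
def gap (a b : ℕ) : ℕ := (a - b) + (b - a)

/-- The distance from `b` to the end of `0, …, n - 1` that lies on the far side of `b` when seen
from `a`. -/
def room (n a b : ℕ) : ℕ := if a < b then n - 1 - b else b

/-- The distance of two vertices of the grid in the coordinates outside `S`. -/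
def gapOff (S : Finset (Fin d)) (p r : Fin d → Fin n) : ℕ := ∑ i ∈ Sᶜ, gap (p i) (r i)

lemma gapOff_congr {S : Finset (Fin d)} {p r p' r' : Fin d → Fin n} (hp : ∀ i ∉ S, p i = p' i)
    (hr : ∀ i ∉ S, r i = r' i) : gapOff S p r = gapOff S p' r' :=
  Finset.sum_congr rfl fun i hi => by
    rw [Finset.mem_compl] at hi
    rw [hp i hi, hr i hi]

lemma gapOff_add_gap {S : Finset (Fin d)} {p r p' r' : Fin d → Fin n} {i : Fin d} (hi : i ∉ S)
    (hp : ∀ j, j ≠ i → p j = p' j) (hr : ∀ j, j ≠ i → r j = r' j) :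
    gapOff S p r + gap (p' i) (r' i) = gapOff S p' r' + gap (p i) (r i) := by
  have hi' : i ∈ Sᶜ := Finset.mem_compl.2 hi
  rw [gapOff, gapOff, ← Finset.add_sum_erase _ _ hi', ← Finset.add_sum_erase _ _ hi',
    Finset.sum_congr rfl (g := fun j => gap (p' j) (r' j)) fun j hj => by
      rw [hp j (Finset.ne_of_mem_erase hj), hr j (Finset.ne_of_mem_erase hj)]]
  omega

lemma gapOff_le (S : Finset (Fin d)) (p r : Fin d → Fin n) : gapOff S p r ≤ d * n := by
  calc gapOff S p r ≤ ∑ i ∈ Sᶜ, n := Finset.sum_le_sum fun i _ => by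
        have := (p i).2; have := (r i).2; unfold gap; omega
    _ ≤ d * n := by
        rw [Finset.sum_const, smul_eq_mul]
        exact Nat.mul_le_mul_right _ ((Finset.card_le_univ _).trans (by simp))

lemma exists_gap_of_gapOff_pos {S : Finset (Fin d)} {p r : Fin d → Fin n} (h : 0 < gapOff S p r) :
    ∃ i ∉ S, (p i : ℕ) ≠ r i := by
  obtain ⟨i, hi, h0⟩ := Finset.exists_ne_zero_of_sum_ne_zero h.ne'
  refine ⟨i, Finset.mem_compl.1 hi, fun he => h0 ?_⟩
  unfold gap; omega

lemma eq_of_gapOff_eq_zero {S : Finset (Fin d)} {p r : Fin d → Fin n} (h : gapOff S p r = 0)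
    (hS : ∀ i ∈ S, (p i : ℕ) = r i) : p = r := by
  funext i
  by_cases hi : i ∈ S
  · exact Fin.ext (hS i hi)
  · have := Finset.sum_eq_zero_iff.1 h i (Finset.mem_compl.2 hi)
    unfold gap at this
    exact Fin.ext (by omega)

/-- A cop can approach the robber by one step in any coordinate where they differ. -/
lemma exists_approach {p r : Fin d → Fin n} {i : Fin d} (h : (p i : ℕ) ≠ r i) :
    ∃ p', Move (grid d n) p p' ∧ (∀ j, j ≠ i → p' j = p j) ∧
      (((p i : ℕ) < r i ∧ (p' i : ℕ) = p i + 1) ∨ ((r i : ℕ) < p i ∧ (p' i : ℕ) + 1 = p i)) := by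
  have h1 := (p i).2
  have h2 := (r i).2
  rcases lt_or_gt_of_ne h with h | h
  · refine ⟨Function.update p i ⟨p i + 1, by omega⟩, move_grid_iff.2 (Or.inr ⟨i, ?_, ?_⟩), ?_, ?_⟩
    · simp
    · intro j hj; simp [hj]
    · intro j hj; simp [hj]
    · simp [h]
  · refine ⟨Function.update p i ⟨p i - 1, by omega⟩, move_grid_iff.2 (Or.inr ⟨i, ?_, ?_⟩), ?_, ?_⟩
    · simp; omega
    · intro j hj; simp [hj]
    · intro j hj; simp [hj]
    · simp; omega

lemma exists_approach_off {S : Finset (Fin d)} {p r : Fin d → Fin n} (h : 0 < gapOff S p r) :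
    ∃ p', Move (grid d n) p p' ∧ (∀ j ∈ S, p' j = p j) ∧
      gapOff S p' r + 1 = gapOff S p r := by
  obtain ⟨i, hi, hne⟩ := exists_gap_of_gapOff_pos h
  obtain ⟨p', hm, hj, hc⟩ := exists_approach hne
  refine ⟨p', hm, fun j hjS => hj j fun h => hi (h ▸ hjS), ?_⟩
  have := gapOff_add_gap (r := r) (r' := r) hi hj (fun _ _ => rfl)
  unfold gap at this
  omega

lemma exists_approach_in {S : Finset (Fin d)} {p r : Fin d → Fin n} {i : Fin d} (hi : i ∈ S)
    (h : (p i : ℕ) ≠ r i) :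
    ∃ p', Move (grid d n) p p' ∧ (∀ j, j ≠ i → p' j = p j) ∧ gapOff S p' r = gapOff S p r ∧
      (((p i : ℕ) < r i ∧ (p' i : ℕ) = p i + 1) ∨ ((r i : ℕ) < p i ∧ (p' i : ℕ) + 1 = p i)) := by
  obtain ⟨p', hm, hj, hc⟩ := exists_approach h
  exact ⟨p', hm, hj, gapOff_congr (fun j hjS => hj j fun h => hjS (h ▸ hi)) fun _ _ => rfl, hc⟩

/-- What a move of the robber does to the distance from a cop, relative to the coordinates `S`. -/
lemma move_cases (S : Finset (Fin d)) (p : Fin d → Fin n) {r r' : Fin d → Fin n}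
    (h : Move (grid d n) r r') : r = r' ∨
    (∃ i ∈ S, ((r i : ℕ) + 1 = r' i ∨ (r' i : ℕ) + 1 = r i) ∧ (∀ j, j ≠ i → r' j = r j) ∧
      gapOff S p r' = gapOff S p r) ∨
    ((∀ j ∈ S, r' j = r j) ∧
      (gapOff S p r' = gapOff S p r + 1 ∨ gapOff S p r' + 1 = gapOff S p r)) := by
  rcases move_grid_iff.1 h with h | ⟨i, h, hj⟩
  · exact Or.inl h
  right
  by_cases hi : i ∈ S
  · exact Or.inl ⟨i, hi, h, fun j hji => (hj j hji).symm, gapOff_congr (fun _ _ => rfl)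
      fun j hjS => (hj j fun h => hjS (h ▸ hi)).symm⟩
  · refine Or.inr ⟨fun j hjS => (hj j fun h => hi (h ▸ hjS)).symm, ?_⟩
    have := gapOff_add_gap (p := p) (p' := p) hi (fun _ _ => rfl) hj
    unfold gap at this
    omega

end Potential

end CopsRobbers

namespace CopsRobbers

/-! ### Linear-time capture by `d / 2 + 1` cops -/

section CopResponses

variable {d n : ℕ}

/-- The potential of a cop who aims at differing from the robber in the coordinate `u` only. -/
def singlePotential (u : Fin d) (p r : Fin d → Fin n) : ℕ :=
  gap (p u) (r u) + gapOff {u} p r +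
    if 0 < gapOff {u} p r then n + gapOff {u} p r else room n (p u) (r u)

/-- The potential of a cop who aims at differing from the robber in the coordinates `u` and `v`
only, and by the same amount. -/
def pairPotential (u v : Fin d) (p r : Fin d → Fin n) : ℕ :=
  gap (p u) (r u) + gap (p v) (r v) + gapOff {u, v} p r +
    if 0 < gapOff {u, v} p r then 4 * n + gapOff {u, v} p r else
    if gap (p v) (r v) < gap (p u) (r u) then
      2 * n + (gap (p u) (r u) - gap (p v) (r v)) + room n (p u) (r u) else
    if gap (p u) (r u) < gap (p v) (r v) then
      2 * n + (gap (p v) (r v) - gap (p u) (r u)) + room n (p v) (r v) else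
    room n (p u) (r u) + room n (p v) (r v)

/-- The distance of the cop from the robber is even. -/
def EvenGap (u v : Fin d) (p r : Fin d → Fin n) : Prop :=
  Even (gap (p u) (r u) + gap (p v) (r v) + gapOff {u, v} p r)

lemma singlePotential_le (u : Fin d) (p r : Fin d → Fin n) :
    singlePotential u p r ≤ (2 * d + 6) * n := by
  have h := gapOff_le {u} p r
  have h1 := (p u).2
  have h2 := (r u).2
  rw [show (2 * d + 6) * n = 2 * (d * n) + 6 * n by ring]
  unfold singlePotential gap room
  split_ifs <;> omega

lemma pairPotential_le (u v : Fin d) (p r : Fin d → Fin n) :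
    pairPotential u v p r ≤ (2 * d + 6) * n := by
  have h := gapOff_le {u, v} p r
  have h1 := (p u).2
  have h2 := (r u).2
  have h3 := (p v).2
  have h4 := (r v).2
  rw [show (2 * d + 6) * n = 2 * (d * n) + 6 * n by ring]
  unfold pairPotential gap room
  split_ifs <;> omega

lemma gap_eq_zero_iff {a b : ℕ} : gap a b = 0 ↔ a = b := by
  unfold gap; omega

/-- Fleeing trades room for gap, approaching does the reverse. The positivity conditions are needed
because the robber changes sides, as seen from `a`, when the gap passes through zero. -/
lemma gap_room_of_robber_step {a b b' : ℕ} (h : b + 1 = b' ∨ b' + 1 = b) (hb : b < n)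
    (hb' : b' < n) :
    (gap a b' = gap a b + 1 ∧ (0 < gap a b → room n a b' + 1 = room n a b)) ∨
    (gap a b' + 1 = gap a b ∧ (0 < gap a b' → room n a b' = room n a b + 1)) := by
  unfold gap room
  split_ifs <;> omega

lemma gap_room_of_cop_step {a a' b : ℕ} (h : (a < b ∧ a' = a + 1) ∨ (b < a ∧ a' + 1 = a)) :
    gap a' b + 1 = gap a b ∧ (0 < gap a' b → room n a' b = room n a b) := by
  unfold gap room
  split_ifs <;> omega

lemma room_lt {a b : ℕ} (hb : b < n) : room n a b < n := by
  unfold room; split_ifs <;> omega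

lemma gap_lt {a b : ℕ} (ha : a < n) (hb : b < n) : gap a b < n := by
  unfold gap; omega

/-- The cop first closes the gaps outside `u`, then those in `u`. While outside gaps remain,
counting them twice makes up for a robber fleeing in `u`. Once they vanish, gap plus room is
unchanged by her moves in `u`, so the cop's approach is pure gain. The summand `n` pays for the
change of regime, as room is below `n`. -/
lemma exists_single_response (u : Fin d) {p r r' : Fin d → Fin n} (h : Move (grid d n) r r') :
    ∃ p', Move (grid d n) p p' ∧
      (p' = r' ∨ singlePotential u p' r' ≤ singlePotential u p r ∧
        (r = r' ∨ r u ≠ r' u → singlePotential u p' r' < singlePotential u p r)) := by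
  have hu : u ∈ ({u} : Finset (Fin d)) := Finset.mem_singleton_self u
  have hroom := room_lt (a := p u) (r' u).2
  by_cases hM : 0 < gapOff {u} p r'
  · obtain ⟨p', hm, hS, hg⟩ := exists_approach_off hM
    have hpu : p' u = p u := hS u hu
    refine ⟨p', hm, Or.inr ?_⟩
    rcases move_cases {u} p h with rfl | ⟨i, hi, hc, hj, hM'⟩ | ⟨hj, hM'⟩
    · simp only [singlePotential, hpu, ← hg]
      constructor <;> (try intro) <;> split_ifs <;> omega
    · obtain rfl := Finset.mem_singleton.1 hi
      have hrob := gap_room_of_robber_step (a := p i) hc (r i).2 (r' i).2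
      simp only [singlePotential, hpu]
      constructor <;> (try intro) <;> split_ifs <;> omega
    · have hru : r' u = r u := hj u hu
      have hrr : r ≠ r' := by rintro rfl; omega
      simp only [singlePotential, hpu, hru, hrr] at hroom ⊢
      refine ⟨?_, by simp⟩
      split_ifs <;> omega
  · by_cases hpu : (p u : ℕ) = r' u
    · refine ⟨p, Move.refl p, Or.inl (eq_of_gapOff_eq_zero (S := {u}) (by omega) ?_)⟩
      simpa using hpu
    obtain ⟨p', hm, hS, hg, hc'⟩ := exists_approach_in hu hpu
    have hcop := gap_room_of_cop_step (n := n) hc'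
    refine ⟨p', hm, ?_⟩
    rcases Nat.eq_zero_or_pos (gap (p' u) (r' u)) with h0 | h0
    · refine Or.inl (eq_of_gapOff_eq_zero (S := {u}) (by omega) ?_)
      simpa using gap_eq_zero_iff.1 h0
    right
    rcases move_cases {u} p h with rfl | ⟨i, hi, hc, hj, hM'⟩ | ⟨hj, hM'⟩
    · simp only [singlePotential, hg]
      constructor <;> (try intro) <;> split_ifs <;> omega
    · obtain rfl := Finset.mem_singleton.1 hi
      have hrob := gap_room_of_robber_step (a := p i) hc (r i).2 (r' i).2
      simp only [singlePotential, hg]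
      constructor <;> (try intro) <;> split_ifs <;> omega
    · have hru : r' u = r u := hj u hu
      have hrr : r ≠ r' := by rintro rfl; omega
      simp only [singlePotential, hg, hru, hrr] at h0 hcop hroom ⊢
      refine ⟨?_, by simp⟩
      split_ifs <;> omega

lemma EvenGap.symm {u v : Fin d} {p r : Fin d → Fin n} (h : EvenGap u v p r) :
    EvenGap v u p r := by
  unfold EvenGap at *
  rwa [Finset.pair_comm v u, add_comm (gap (p v) (r v))]

lemma pairPotential_comm (u v : Fin d) (p r : Fin d → Fin n) :
    pairPotential u v p r = pairPotential v u p r := by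
  unfold pairPotential
  rw [Finset.pair_comm v u]
  split_ifs <;> omega

/-- The cop reduces the larger gap. With unequal gaps, their sum, their difference and the room in
the larger one together drop. With equal gaps, fleeing costs room in the coordinate moved, while
approaching lets the cop gain in the other one: the gaps lose two and the room grows by only one.
The offsets `2 * n` and `4 * n` pay for the changes of regime. -/
lemma exists_pair_response_of_lt {u v : Fin d} (huv : u ≠ v) {p r r' : Fin d → Fin n}
    (h : Move (grid d n) r r') (hE : EvenGap u v p r)
    (hM : gapOff {u, v} p r' = 0) (hlt : gap (p v) (r' v) < gap (p u) (r' u)) (hrr : r ≠ r') :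
    ∃ p', Move (grid d n) p p' ∧
      (p' = r' ∨ EvenGap u v p' r' ∧ pairPotential u v p' r' ≤ pairPotential u v p r ∧
        (r u ≠ r' u ∨ r v ≠ r' v → pairPotential u v p' r' < pairPotential u v p r)) := by
  have hrv' := room_lt (a := p v) (r' v).2
  have hru' := room_lt (a := p u) (r' u).2
  have hgu := gap_lt (p u).2 (r' u).2
  have hpu : (p u : ℕ) ≠ r' u := fun h => by rw [gap_eq_zero_iff.2 h] at hlt; omega
  obtain ⟨p', hm, hS, hg, hc'⟩ := exists_approach_in (Finset.mem_insert_self u {v}) hpu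
  have hpv : p' v = p v := hS v huv.symm
  have hcop := gap_room_of_cop_step (n := n) hc'
  refine ⟨p', hm, ?_⟩
  rcases Nat.eq_zero_or_pos (gap (p' u) (r' u)) with h0 | h0
  · refine Or.inl (eq_of_gapOff_eq_zero (S := {u, v}) (by omega) ?_)
    have h1 : gap (p' v) (r' v) = 0 := by rw [hpv]; omega
    simpa using ⟨gap_eq_zero_iff.1 h0, gap_eq_zero_iff.1 h1⟩
  right
  rw [EvenGap, Nat.even_iff] at *
  rcases move_cases {u, v} p h with h | ⟨i, hi, hc, hj, hM'⟩ | ⟨hj, hM'⟩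
  · exact absurd h hrr
  · have hrob := gap_room_of_robber_step (a := p i) hc (r i).2 (r' i).2
    rw [Finset.mem_insert, Finset.mem_singleton] at hi
    rcases hi with rfl | rfl
    · have hv := hj v huv.symm
      simp only [pairPotential, hg, hM, hpv, hv, ← hM'] at *
      clear hj hS hM hM' hc hc' hv hpv hg
      refine ⟨by omega, ?_⟩
      constructor <;> (try intro) <;> split_ifs <;> omega
    · have hu := hj u huv
      simp only [pairPotential, hg, hM, hpv, hu, ← hM'] at *
      clear hj hS hM hM' hc hc' hu hpv hg
      refine ⟨by omega, ?_⟩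
      constructor <;> (try intro) <;> split_ifs <;> omega
  · have hu := hj u (by simp)
    have hv := hj v (by simp)
    simp only [pairPotential, hg, hM, hpv, hu, hv] at *
    clear hj hS hu hv hpv hg
    refine ⟨by omega, ?_, by simp⟩
    split_ifs <;> omega

lemma exists_pair_response {u v : Fin d} (huv : u ≠ v) {p r r' : Fin d → Fin n}
    (h : Move (grid d n) r r') (hE : EvenGap u v p r) :
    ∃ p', Move (grid d n) p p' ∧
      (p' = r' ∨ EvenGap u v p' r' ∧ pairPotential u v p' r' ≤ pairPotential u v p r ∧
        (r u ≠ r' u ∨ r v ≠ r' v → pairPotential u v p' r' < pairPotential u v p r)) := by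
  by_cases hrr : r = r'
  -- Answering a pass by a pass preserves parity; passes are left to the single-coordinate cop.
  · subst hrr
    exact ⟨p, Move.refl p, Or.inr ⟨hE, le_rfl, by simp⟩⟩
  rcases Nat.eq_zero_or_pos (gapOff {u, v} p r') with hM | hM
  · rcases lt_trichotomy (gap (p v) (r' v)) (gap (p u) (r' u)) with hlt | heq | hlt
    · exact exists_pair_response_of_lt huv h hE hM hlt hrr
    -- The distance was even and a genuine robber move makes it odd, which rules out two equal gaps
    -- with nothing outside.
    · exfalso
      rw [EvenGap, Nat.even_iff] at hE
      rcases move_cases {u, v} p h with h | ⟨i, hi, hc, hj, hM'⟩ | ⟨hj, hM'⟩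
      · exact absurd h hrr
      · rw [Finset.mem_insert, Finset.mem_singleton] at hi
        rcases hi with rfl | rfl
        · have hv := hj v huv.symm
          rw [hv] at heq
          unfold gap at *
          omega
        · have hu := hj u huv
          rw [hu] at heq
          unfold gap at *
          omega
      · rw [hj u (by simp), hj v (by simp)] at heq
        unfold gap at *
        omega
    · obtain ⟨p', hm, hp'⟩ := exists_pair_response_of_lt huv.symm h hE.symm
        (by rwa [Finset.pair_comm]) hlt hrr
      refine ⟨p', hm, hp'.imp_right fun ⟨h1, h2, h3⟩ => ⟨h1.symm, ?_, fun h4 => ?_⟩⟩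
      · rwa [pairPotential_comm u v, pairPotential_comm u v p]
      · rw [pairPotential_comm u v, pairPotential_comm u v p]
        exact h3 h4.symm
  · obtain ⟨p', hm, hS, hg⟩ := exists_approach_off hM
    have hpu : p' u = p u := hS u (by simp)
    have hpv : p' v = p v := hS v (by simp)
    have hrv' := room_lt (a := p v) (r' v).2
    have hru' := room_lt (a := p u) (r' u).2
    have hgv := gap_lt (p v).2 (r' v).2
    have hgu := gap_lt (p u).2 (r' u).2
    refine ⟨p', hm, Or.inr ?_⟩
    rw [EvenGap, Nat.even_iff] at *
    rcases move_cases {u, v} p h with h | ⟨i, hi, hc, hj, hM'⟩ | ⟨hj, hM'⟩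
    · exact absurd h hrr
    · have hrob := gap_room_of_robber_step (a := p i) hc (r i).2 (r' i).2
      rw [Finset.mem_insert, Finset.mem_singleton] at hi
      rcases hi with rfl | rfl
      · have hv := hj v huv.symm
        simp only [pairPotential, hpu, hpv, hv] at *
        clear hj hS hc hv hpv
        refine ⟨by omega, ?_⟩
        constructor <;> (try intro) <;> split_ifs <;> omega
      · have hu := hj u huv
        simp only [pairPotential, hpu, hpv, hu] at *
        clear hj hS hc hu hpv
        refine ⟨by omega, ?_⟩
        constructor <;> (try intro) <;> split_ifs <;> omega
    · have hu := hj u (by simp)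
      have hv := hj v (by simp)
      simp only [pairPotential, hpu, hpv, hu, hv] at *
      clear hj hS hu hv hpv
      refine ⟨by omega, ?_, by simp⟩
      split_ifs <;> omega

/-- In the first round each pair cop can correct the parity: an odd distance is positive, so an
approaching step exists. -/
lemma exists_evenGap {u v : Fin d} (huv : u ≠ v) (s r : Fin d → Fin n) :
    ∃ p, Move (grid d n) s p ∧ EvenGap u v p r := by
  by_cases hE : EvenGap u v s r
  · exact ⟨s, Move.refl s, hE⟩
  rw [EvenGap, Nat.even_iff] at hE
  by_cases hM : 0 < gapOff {u, v} s r
  · obtain ⟨p', hm, hS, hg⟩ := exists_approach_off hM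
    refine ⟨p', hm, ?_⟩
    rw [EvenGap, Nat.even_iff, hS u (by simp), hS v (by simp)]
    omega
  have key : ∃ i ∈ ({u, v} : Finset (Fin d)), (s i : ℕ) ≠ r i := by
    by_contra! hcon
    have h1 := hcon u (by simp)
    have h2 := hcon v (by simp)
    unfold gap at hE
    omega
  obtain ⟨i, hi, hne⟩ := key
  obtain ⟨p', hm, hS, hg, hc⟩ := exists_approach_in hi hne
  refine ⟨p', hm, ?_⟩
  rw [EvenGap, Nat.even_iff]
  rw [Finset.mem_insert, Finset.mem_singleton] at hi
  unfold gap at *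
  rcases hi with rfl | rfl
  · rw [hS v huv.symm]
    omega
  · rw [hS u huv]
    omega

/-- On the `d`-dimensional grid `d / 2 + 1` cops catch the robber in linear time. -/
theorem exists_catchesBy_grid (hd : 1 ≤ d) (hn : 1 ≤ n) :
    ∃ σ : CopStrategy (grid d n) (d / 2 + 1),
      σ.CatchesBy ((d / 2 + 1) * ((2 * d + 6) * n) + 1) := by
  let e : Fin d := ⟨0, hd⟩
  -- The pairs are (1, 2), (3, 4), and so on; for even `d` the last one wraps around to `(d - 1,
  -- 0)`. Coordinate 0 belongs to the single-coordinate cop.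
  let u : Fin (d / 2) → Fin d := fun j => ⟨2 * j + 1, by omega⟩
  let v : Fin (d / 2) → Fin d := fun j => ⟨(2 * j + 2) % d, Nat.mod_lt _ hd⟩
  have huv : ∀ j, u j ≠ v j := by
    intro j h
    have h' : 2 * (j : ℕ) + 1 = (2 * j + 2) % d := congrArg Fin.val h
    have hj := j.2
    rcases Nat.lt_or_ge (2 * j + 2) d with hlt | hge
    · rw [Nat.mod_eq_of_lt hlt] at h'
      omega
    · rw [show 2 * (j : ℕ) + 2 = d by omega, Nat.mod_self] at h'
      omega
  have hcov : ∀ i : Fin d, i = e ∨ ∃ j, i = u j ∨ i = v j := by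
    intro i
    have hi := i.2
    by_cases h0 : (i : ℕ) = 0
    · exact Or.inl (Fin.ext h0)
    right
    rcases Nat.even_or_odd (i : ℕ) with ⟨a, ha⟩ | ⟨a, ha⟩
    · refine ⟨⟨a - 1, by omega⟩, Or.inr (Fin.ext ?_)⟩
      change (i : ℕ) = (2 * (a - 1) + 2) % d
      rw [Nat.mod_eq_of_lt] <;> omega
    · exact ⟨⟨a, by omega⟩, Or.inl (Fin.ext ha)⟩
  refine exists_catchesBy_of_potential (fun _ => ⟨0, hn⟩)
    (Fin.cases (fun _ _ => True) fun j => EvenGap (u j) (v j))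
    (Fin.cases (fun r r' => r = r' ∨ r e ≠ r' e) fun j r r' => r (u j) ≠ r' (u j) ∨
      r (v j) ≠ r' (v j))
    (Fin.cases (singlePotential e) fun j => pairPotential (u j) (v j)) _ ?_ ?_ ?_ ?_
  · intro i r
    cases i using Fin.cases with
    | zero => exact ⟨_, Move.refl _, trivial⟩
    | succ j => exact exists_evenGap (huv j) _ r
  · intro i p r r' hm hI
    cases i using Fin.cases with
    | zero =>
      obtain ⟨p', h1, h2⟩ := exists_single_response e hm
      exact ⟨p', h1, h2.imp_right fun h => ⟨trivial, h⟩⟩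
    | succ j => exact exists_pair_response (huv j) hm hI
  · intro r r' hm
    rcases move_grid_iff.1 hm with h | ⟨i, hi, -⟩
    · exact ⟨0, Or.inl h⟩
    have hne : r i ≠ r' i := fun h => by rw [h] at hi; omega
    rcases hcov i with rfl | ⟨j, rfl | rfl⟩
    · exact ⟨0, Or.inr hne⟩
    · exact ⟨j.succ, Or.inl hne⟩
    · exact ⟨j.succ, Or.inr hne⟩
  · intro p r
    refine (Finset.sum_le_card_nsmul Finset.univ _ ((2 * d + 6) * n) fun i _ => ?_).trans
      (by simp)
    cases i using Fin.cases with
    | zero => exact singlePotential_le _ _ _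
    | succ j => exact pairPotential_le _ _ _ _

end CopResponses

end CopsRobbers

namespace CopsRobbers

/-! ### Covering the grid by boxes and chasing shadows -/

section Boxes

variable {d n s m : ℕ}

/-- The least coordinates of the box of side `s` with index `b`, in the grid of side `n`. -/
def boxCorner (n s : ℕ) (b : Fin d → Fin m) (i : Fin d) : ℕ := min (b i * s) (n - s)

/-- The inclusion of a box of side `s` in the grid of side `n`. -/
def boxEmbed (hsn : s ≤ n) (b : Fin d → Fin m) (x : Fin d → Fin s) : Fin d → Fin n := fun i =>
  ⟨boxCorner n s b i + x i, by have := (x i).2; unfold boxCorner; omega⟩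

/-- The retraction of the grid of side `n` onto a box of side `s`. -/
def boxShadow (hs : 1 ≤ s) (b : Fin d → Fin m) (r : Fin d → Fin n) : Fin d → Fin s := fun i =>
  ⟨min (r i - boxCorner n s b i) (s - 1), by omega⟩

lemma Move.boxEmbed (hsn : s ≤ n) (b : Fin d → Fin m) {x y : Fin d → Fin s}
    (h : Move (grid d s) x y) : Move (grid d n) (boxEmbed hsn b x) (boxEmbed hsn b y) := by
  rw [move_grid_iff] at *
  rcases h with rfl | ⟨i, h, hj⟩
  · exact Or.inl rfl
  · refine Or.inr ⟨i, ?_, fun j hji => ?_⟩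
    · simp only [CopsRobbers.boxEmbed]
      omega
    · simp [CopsRobbers.boxEmbed, hj j hji]

/-- Clamping a coordinate to an interval, from below by truncated subtraction and from above by
`min`, is 1-Lipschitz. -/
lemma Move.boxShadow (hs : 1 ≤ s) (b : Fin d → Fin m) {x y : Fin d → Fin n}
    (h : Move (grid d n) x y) : Move (grid d s) (boxShadow hs b x) (boxShadow hs b y) := by
  rw [move_grid_iff] at *
  rcases h with rfl | ⟨i, h, hj⟩
  · exact Or.inl rfl
  · have hj' : ∀ j, j ≠ i → CopsRobbers.boxShadow hs b x j = CopsRobbers.boxShadow hs b y j :=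
      fun j hji => by simp [CopsRobbers.boxShadow, hj j hji]
    by_cases hi : CopsRobbers.boxShadow hs b x i = CopsRobbers.boxShadow hs b y i
    · refine Or.inl (funext fun j => ?_)
      by_cases hji : j = i
      · exact hji ▸ hi
      · exact hj' j hji
    · refine Or.inr ⟨i, ?_, hj'⟩
      rw [Fin.ext_iff] at hi
      simp only [CopsRobbers.boxShadow] at hi ⊢
      omega

/-- Division by `s` finds a box containing the vertex. Moving an overhanging box back to the corner
`n - s` does not lose the vertex. -/
lemma exists_boxEmbed_boxShadow (hs : 1 ≤ s) (hsn : s ≤ n) (hm : n ≤ s * m) (r : Fin d → Fin n) :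
    ∃ b : Fin d → Fin m, boxEmbed hsn b (boxShadow hs b r) = r := by
  refine ⟨fun i => ⟨r i / s, Nat.div_lt_of_lt_mul ((r i).2.trans_le hm)⟩, funext fun i => ?_⟩
  apply Fin.ext
  have h1 := Nat.div_add_mod' (r i : ℕ) s
  have h2 := Nat.mod_lt (r i : ℕ) hs
  have h3 := (r i).2
  simp only [boxEmbed, boxShadow, boxCorner]
  omega

/-- Teams of cops that chase the shadows of the robber in the boxes of a cover of the grid catch
the robber as soon as every team has caught its shadow. -/
theorem exists_catchesBy_of_boxes {c k T : ℕ} (hc : 1 ≤ c) (hs : 1 ≤ s) (hm1 : 1 ≤ m) (hsn : s ≤ n)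
    (hm : n ≤ s * m) (hk : c * m ^ d ≤ k) {σ : CopStrategy (grid d s) c} (hσ : σ.CatchesBy T) :
    ∃ τ : CopStrategy (grid d n) k, τ.CatchesBy T := by
  have : Nonempty ((Fin d → Fin m) × Fin c) := ⟨(fun _ => ⟨0, hm1⟩, ⟨0, hc⟩)⟩
  -- Surplus cops duplicate the role of others.
  obtain ⟨f, hf⟩ : ∃ f : Fin k → (Fin d → Fin m) × Fin c, Function.Surjective f := by
    have hcard : Fintype.card ((Fin d → Fin m) × Fin c) ≤ Fintype.card (Fin k) := by
      simpa [mul_comm] using hk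
    obtain ⟨g⟩ := Function.Embedding.nonempty_of_card_le hcard
    exact ⟨Function.invFun g, Function.invFun_surjective g.injective⟩
  refine ⟨⟨fun h i => boxEmbed hsn (f i).1 (σ.pos (h.map (boxShadow hs (f i).1)) (f i).2),
    fun h v i => ?_⟩, fun r hr => ?_⟩
  · rw [List.map_append]
    exact (σ.legal _ _ _).boxEmbed hsn _
  -- Only the robber's box at time `T` matters, since every team is then on its shadow.
  · obtain ⟨b, hb⟩ := exists_boxEmbed_boxShadow hs hsn hm (r T)
    obtain ⟨j, hj⟩ := hσ (fun t => boxShadow hs b (r t)) fun t => (hr t).boxShadow hs b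
    obtain ⟨i, hi⟩ := hf (b, j)
    refine ⟨i, ?_⟩
    simp only [CopStrategy.copsAt, hi, List.map_map] at hj ⊢
    rw [← hb, ← hj]
    rfl

end Boxes

/-! ### Lower bound on the cop number -/

section CopNumber

variable {V : Type*} {G : SimpleGraph V} {k : ℕ}

/-- The history of a robber who always reacts to the positions of the cops by `next`. -/
def evasionHistory (σ : CopStrategy G k) (next : (Fin k → V) → V → V) (v₀ : V) : ℕ → List V × V
  | 0 => ([], v₀)
  | t + 1 =>
    let h := evasionHistory σ next v₀ t
    (h.1 ++ [h.2], next (σ.pos (h.1 ++ [h.2])) h.2)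

/-- The robber keeps outside all closed neighbourhoods of the cops after each of her moves, so no
cop can reach her on the next turn. -/
lemma not_copsWin_of_evasion
    (h0 : ∀ q : Fin k → V, ∃ w, ∀ i, ¬ Move G (q i) w)
    (hstep : ∀ (q : Fin k → V) (v : V), (∀ i, q i ≠ v) → ∃ w, Move G v w ∧ ∀ i, ¬ Move G (q i) w) :
    ¬ CopsWin G k := by
  rintro ⟨σ, hσ⟩
  have hstep' : ∀ (q : Fin k → V) (v : V), ∃ w, Move G v w ∧
      ((∀ i, q i ≠ v) → ∀ i, ¬ Move G (q i) w) := by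
    intro q v
    by_cases h : ∀ i, q i ≠ v
    · obtain ⟨w, h1, h2⟩ := hstep q v h
      exact ⟨w, h1, fun _ => h2⟩
    · exact ⟨v, Or.inl rfl, fun h' => absurd h' h⟩
  choose next hnext hsafe using hstep'
  obtain ⟨v₀, hv₀⟩ := h0 (σ.pos [])
  set H := evasionHistory σ next v₀ with hH
  set r : ℕ → V := fun t => (H t).2 with hr
  have hist : ∀ t, (H t).1 = (List.range t).map r := by
    intro t
    induction t with
    | zero => rfl
    | succ t ih =>
      rw [List.range_succ, List.map_append, ← ih]
      rfl
  have hcops : ∀ t, σ.copsAt r t = σ.pos (H t).1 := fun t => by rw [hist]; rfl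
  have hrsucc : ∀ t, r (t + 1) = next (σ.pos (H (t + 1)).1) (r t) := fun t => rfl
  have inv : ∀ t i, ¬ Move G (σ.copsAt r t i) (r t) ∧ σ.copsAt r (t + 1) i ≠ r t := by
    have aux : ∀ t, (∀ i, ¬ Move G (σ.copsAt r t i) (r t)) → ∀ i, σ.copsAt r (t + 1) i ≠ r t := by
      intro t h i he
      apply h i
      rw [← he, hcops, hcops]
      exact σ.legal _ _ _
    have main : ∀ t i, ¬ Move G (σ.copsAt r t i) (r t) := by
      intro t
      induction t with
      | zero => exact hv₀
      | succ t ih =>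
        have := hsafe (σ.pos (H (t + 1)).1) (r t) fun i => by
          rw [← hcops]
          exact aux t ih i
        intro i
        rw [hrsucc, hcops]
        exact this i
    exact fun t i => ⟨main t i, aux t (main t) i⟩
  obtain ⟨t, ⟨i, hi⟩ | ⟨s, rfl, i, hi⟩⟩ := hσ r fun t => by
    rw [hrsucc]
    exact hnext _ _
  · exact (inv t i).1 (Or.inl hi)
  · exact (inv s i).2 hi

variable {d n : ℕ}

/-- If no cop is adjacent, she stays. Otherwise consider one neighbour of `v` in each of the `d`
directions: a cop guards at most two of them and an adjacent cop at most one, so fewer than `2 * k ≤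
d` are guarded. -/
lemma exists_move_avoiding (hn : 2 ≤ n) (hk : 2 * k ≤ d) (q : Fin k → Fin d → Fin n)
    (v : Fin d → Fin n) (hq : ∀ i, q i ≠ v) :
    ∃ w, Move (grid d n) v w ∧ ∀ i, ¬ Move (grid d n) (q i) w := by
  classical
  by_cases hadj : ∃ i, Move (grid d n) (q i) v
  swap
  · push Not at hadj
    exact ⟨v, Move.refl v, hadj⟩
  obtain ⟨i₀, hi₀⟩ := hadj
  have hw : ∀ j : Fin d, ∃ w : Fin d → Fin n, ((w j : ℕ) + 1 = v j ∨ (v j : ℕ) + 1 = w j) ∧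
      ∀ l, l ≠ j → w l = v l := by
    intro j
    have hj := (v j).2
    by_cases h : (v j : ℕ) = 0
    · refine ⟨Function.update v j ⟨1, by omega⟩, ?_, fun l hl => by simp [hl]⟩
      simp [h]
    · refine ⟨Function.update v j ⟨v j - 1, by omega⟩, ?_, fun l hl => by simp [hl]⟩
      simp; omega
  choose w hw1 hw2 using hw
  have hwj : ∀ j, w j j ≠ v j := fun j h => by have := hw1 j; rw [h] at this; omega
  let D : Fin k → Finset (Fin d) := fun i => Finset.univ.filter fun l => q i l ≠ v l
  let T : Fin k → Finset (Fin d) := fun i =>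
    Finset.univ.filter fun j => Move (grid d n) (q i) (w j)
  -- A cop agreeing with `v` in coordinate `j` can only reach `w j` by a step in that coordinate,
  -- which would put the cop on `v`.
  have hTD : ∀ i, T i ⊆ D i := by
    intro i j hj
    simp only [T, D, Finset.mem_filter, Finset.mem_univ, true_and] at hj ⊢
    intro hjv
    rcases move_grid_iff.1 hj with h | ⟨l, -, hl⟩
    · exact hwj j (by rw [← h, hjv])
    · by_cases hlj : l = j
      · subst hlj
        refine hq i (funext fun a => ?_)
        by_cases ha : a = l
        · exact ha ▸ hjv
        · rw [hl a ha, hw2 l a ha]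
      · exact hwj j (by rw [← hl j (Ne.symm hlj), hjv])
  have hT2 : ∀ i, (T i).card ≤ 2 := by
    intro i
    rcases (T i).eq_empty_or_nonempty with h | ⟨j, hj⟩
    · simp [h]
    refine (Finset.card_le_card (hTD i)).trans ?_
    have hj' : Move (grid d n) (q i) (w j) := (Finset.mem_filter.1 hj).2
    obtain ⟨l, hl⟩ : ∃ l, ∀ a, a ≠ l → q i a = w j a := by
      rcases move_grid_iff.1 hj' with h | ⟨l, -, hl⟩
      · exact ⟨j, fun a _ => by rw [h]⟩
      · exact ⟨l, hl⟩
    refine (Finset.card_le_card (t := {j, l}) fun a ha => ?_).trans Finset.card_le_two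
    rw [Finset.mem_insert, Finset.mem_singleton]
    by_contra! hcon
    exact (Finset.mem_filter.1 ha).2 (by rw [hl a hcon.2, hw2 j a hcon.1])
  have hT1 : (T i₀).card ≤ 1 := by
    refine (Finset.card_le_card (hTD i₀)).trans ?_
    rcases move_grid_iff.1 hi₀ with h | ⟨l, -, hl⟩
    · exact absurd h (hq i₀)
    refine (Finset.card_le_card (t := {l}) fun a ha => ?_).trans (Finset.card_singleton l).le
    rw [Finset.mem_singleton]
    by_contra hcon
    exact (Finset.mem_filter.1 ha).2 (hl a hcon)
  have hsum : ∑ i, (T i).card < d := by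
    refine lt_of_lt_of_le (Finset.sum_lt_sum (g := fun _ => 2) (fun i _ => hT2 i)
      ⟨i₀, Finset.mem_univ _, by omega⟩) ?_
    simpa [mul_comm] using hk
  obtain ⟨j, hj⟩ : ∃ j, j ∉ Finset.univ.biUnion T := by
    by_contra! hcon
    have : (Finset.univ.biUnion T) = Finset.univ := Finset.eq_univ_of_forall hcon
    have h2 := Finset.card_biUnion_le (s := Finset.univ) (t := T)
    rw [this, Finset.card_univ, Fintype.card_fin] at h2
    omega
  refine ⟨w j, move_grid_iff.2 (Or.inr ⟨j, (hw1 j).symm, fun l hl => (hw2 j l hl).symm⟩),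
    fun i hi => hj ?_⟩
  exact Finset.mem_biUnion.2 ⟨i, Finset.mem_univ i, Finset.mem_filter.2 ⟨Finset.mem_univ j, hi⟩⟩

/-- Each cop excludes at most three values of the first coordinate. -/
lemma exists_avoiding (hd : 1 ≤ d) (hn : 3 * k < n) (q : Fin k → Fin d → Fin n) :
    ∃ w, ∀ i, ¬ Move (grid d n) (q i) w := by
  classical
  let e : Fin d := ⟨0, hd⟩
  let B : Finset ℕ := Finset.univ.biUnion fun i : Fin k =>
    {(q i e : ℕ), (q i e : ℕ) + 1, (q i e : ℕ) - 1}
  have hB : B.card < (Finset.range n).card := by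
    refine lt_of_le_of_lt (Finset.card_biUnion_le.trans
      (Finset.sum_le_card_nsmul _ _ 3 fun i _ => Finset.card_le_three)) ?_
    simp; omega
  obtain ⟨a, ha, haB⟩ := Finset.exists_mem_notMem_of_card_lt_card hB
  refine ⟨fun _ => ⟨a, Finset.mem_range.1 ha⟩, fun i hi => haB ?_⟩
  refine Finset.mem_biUnion.2 ⟨i, Finset.mem_univ i, ?_⟩
  simp only [Finset.mem_insert, Finset.mem_singleton]
  rcases move_grid_iff.1 hi with h | ⟨l, hl, hj⟩
  · have := congrArg Fin.val (congrFun h e)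
    simp at this
    omega
  · by_cases hle : l = e
    · subst hle
      simp at hl
      omega
    · have := congrArg Fin.val (hj e (Ne.symm hle))
      simp at this
      omega

theorem lt_two_mul_of_copsWin_grid (hd : 1 ≤ d) (hn : 3 * d < n) (h : CopsWin (grid d n) k) :
    d < 2 * k := by
  by_contra! hk
  exact not_copsWin_of_evasion (exists_avoiding hd (by omega))
    (exists_move_avoiding (by omega) hk) h

theorem lt_two_mul_of_copNumber_le (hd : 1 ≤ d) (hn : 3 * d < n)
    (h : copNumber (grid d n) ≤ (k : ℕ∞)) : d < 2 * k := by
  have : ∃ j, CopsWin (grid d n) j ∧ j ≤ k := by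
    by_contra! hcon
    have h1 : ((k + 1 : ℕ) : ℕ∞) ≤ copNumber (grid d n) :=
      le_iInf₂ fun j hj => by exact_mod_cast hcon j hj
    have h2 : k + 1 ≤ k := by exact_mod_cast h1.trans h
    omega
  obtain ⟨j, hj, hjk⟩ := this
  have := lt_two_mul_of_copsWin_grid hd hn hj
  omega

end CopNumber

/-! ### Capture time and the motionless robber -/

section CaptureTime

variable {d n k T : ℕ}

lemma captureTime_le {V : Type*} {G : SimpleGraph V} (h : CopsWinWithin G k T) :
    captureTime G k ≤ T := iInf₂_le T h

lemma copsWinWithin_toNat_captureTime {V : Type*} {G : SimpleGraph V}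
    (h : captureTime G k ≠ ⊤) : CopsWinWithin G k (captureTime G k).toNat := by
  by_contra hcon
  have hlt : ∀ T, CopsWinWithin G k T → (captureTime G k).toNat + 1 ≤ T := by
    intro T hT
    by_contra! hle
    have h1 := ENat.toNat_le_of_le_natCast (captureTime_le hT)
    obtain rfl : T = (captureTime G k).toNat := by omega
    exact hcon hT
  have h1 : (((captureTime G k).toNat + 1 : ℕ) : ℕ∞) ≤ captureTime G k :=
    le_iInf₂ fun T hT => by exact_mod_cast hlt T hT
  rw [← ENat.natCast_toNat h] at h1
  have h2 : (captureTime G k).toNat + 1 ≤ (captureTime G k).toNat := by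
    simpa using (Nat.cast_le (α := ℕ∞)).1 h1
  omega

/-- A robber who does not move is only captured within `T` rounds if the cops start close to her. -/
theorem pow_le_of_copsWinWithin (h : CopsWinWithin (grid d n) k T) :
    n ^ d ≤ k * (2 * T + 1) ^ d := by
  classical
  obtain ⟨σ, hσ⟩ := h
  have hdist : ∀ (w : Fin d → Fin n) (t : ℕ) (i : Fin k) (j : Fin d),
      gap (σ.pos [] i j) (σ.copsAt (fun _ => w) t i j) ≤ t := by
    intro w t i j
    induction t with
    | zero => simp [CopStrategy.copsAt, gap]
    | succ t ih =>
      have := σ.legal ((List.range t).map fun _ => w) w i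
      have h2 : σ.copsAt (fun _ => w) (t + 1) i =
          σ.pos ((List.range t).map (fun _ => w) ++ [w]) i := by
        simp [CopStrategy.copsAt, List.range_succ]
      rw [← h2] at this
      change Move _ (σ.copsAt (fun _ => w) t i) _ at this
      rcases move_grid_iff.1 this with h | ⟨l, hl, hj⟩
      · rw [← h]; omega
      · by_cases hlj : j = l
        · subst hlj
          unfold gap at *
          omega
        · rw [← hj j hlj]; omega
  let S : Fin k → Finset (Fin d → Fin n) := fun i =>
    Fintype.piFinset fun j => Finset.univ.filter fun a : Fin n => gap (σ.pos [] i j) a ≤ T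
  have hcov : Finset.univ ⊆ Finset.univ.biUnion S := by
    intro w _
    have hmem : ∃ i t, t ≤ T ∧ σ.copsAt (fun _ => w) t i = w := by
      obtain ⟨t, ht, ⟨i, hi⟩ | ⟨s, -, i, hi⟩⟩ := hσ (fun _ => w) fun _ => Move.refl w
      · exact ⟨i, t, ht, hi⟩
      · exact ⟨i, t, ht, hi⟩
    obtain ⟨i, t, ht, hi⟩ := hmem
    refine Finset.mem_biUnion.2 ⟨i, Finset.mem_univ i, Fintype.mem_piFinset.2 fun j => ?_⟩
    have := hdist w t i j
    rw [hi] at this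
    exact Finset.mem_filter.2 ⟨Finset.mem_univ _, this.trans ht⟩
  have hS : ∀ i, (S i).card ≤ (2 * T + 1) ^ d := by
    intro i
    rw [Fintype.card_piFinset]
    -- In each coordinate an interval of radius `T` has at most `2 * T + 1` points.
    refine (Finset.prod_le_pow_card _ _ (2 * T + 1) fun j _ => ?_).trans (by simp)
    rw [← Finset.card_map Fin.valEmbedding]
    refine (Finset.card_le_card (t := Finset.Icc ((σ.pos [] i j : ℕ) - T) (σ.pos [] i j + T))
      fun a ha => ?_).trans ?_
    · simp only [Finset.mem_map, Finset.mem_filter, Finset.mem_univ, true_and] at ha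
      obtain ⟨b, hb, rfl⟩ := ha
      unfold gap at hb
      rw [Finset.mem_Icc]
      change _ ≤ (b : ℕ) ∧ (b : ℕ) ≤ _
      omega
    · rw [Nat.card_Icc]; omega
  have h1 := (Finset.card_le_card hcov).trans (Finset.card_biUnion_le.trans
    (Finset.sum_le_card_nsmul _ _ _ fun i _ => hS i))
  simpa using h1

end CaptureTime

end CopsRobbers

namespace CopsRobbers

/-! ### Choice of parameters and asymptotics -/

section Asymptotics

variable {d n k : ℕ}

lemma exists_side_length {m : ℕ} (hn : 1 ≤ n) (hm : 1 ≤ m) :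
    ∃ s, 1 ≤ s ∧ s ≤ n ∧ n ≤ s * m ∧ s * m ≤ n + m := by
  have hn' := Nat.div_add_mod' (n - 1) m
  have hlt := Nat.mod_lt (n - 1) hm
  have hle := Nat.div_le_self (n - 1) m
  refine ⟨(n - 1) / m + 1, Nat.le_add_left 1 _, by omega, ?_, ?_⟩ <;> rw [add_mul] <;> omega

/-- If there are enough cops for `m ^ d` teams, with `m` as large as possible, the capture time is
at most linear in `n / m`. -/
theorem exists_captureTime_grid_le (hd : 1 ≤ d) (hn : 1 ≤ n) (hk : d < 2 * k) {K : ℕ}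
    (hkn : k ≤ K * n ^ d) : ∃ T m : ℕ, captureTime (grid d n) k ≤ T ∧ 1 ≤ m ∧
      k ≤ (2 * (d / 2 + 1) * m) ^ d ∧
      T * m ≤ ((d / 2 + 1) * (2 * d + 6) + 2) * ((1 + K) * n) := by
  set c := d / 2 + 1 with hc
  have hck : c ≤ k := by omega
  have hd0 : d ≠ 0 := by omega
  set m := Nat.findGreatest (fun m => c * m ^ d ≤ k) k with hm
  have hm1 : 1 ≤ m := Nat.le_findGreatest (by omega) (by simpa using hck)
  have hmk : c * m ^ d ≤ k :=
    Nat.findGreatest_spec (P := fun m => c * m ^ d ≤ k) (m := 1) (by omega) (by simpa using hck)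
  have hkm : k < c * (m + 1) ^ d := by
    by_contra! hcon
    have h1 : m + 1 ≤ k :=
      (Nat.le_self_pow hd0 _).trans ((Nat.le_mul_of_pos_left _ (by omega)).trans hcon)
    have := Nat.le_findGreatest (P := fun m => c * m ^ d ≤ k) h1 hcon
    omega
  -- Maximality of `m` makes it comparable with `k ^ (1 / d)`.
  have hk1 : k ≤ (2 * c * m) ^ d := by
    calc k ≤ c * (m + 1) ^ d := hkm.le
      _ ≤ c ^ d * (2 * m) ^ d :=
        Nat.mul_le_mul (Nat.le_self_pow hd0 _) (Nat.pow_le_pow_left (by omega) _)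
      _ = (2 * c * m) ^ d := by rw [← mul_pow]; ring
  have hK : 1 ≤ K := by
    rcases Nat.eq_zero_or_pos K with h | h
    · subst h; omega
    · exact h
  -- Here `k = O(n ^ d)` enters: it bounds the rounding error `m` in `s * m ≤ n + m` by a multiple
  -- of `n`.
  have hmn : m ≤ K * n := by
    have h1 : m ^ d ≤ (K * n) ^ d := by
      calc m ^ d ≤ c * m ^ d := Nat.le_mul_of_pos_left _ (by omega)
        _ ≤ K * n ^ d := hmk.trans hkn
        _ ≤ K ^ d * n ^ d := Nat.mul_le_mul_right _ (Nat.le_self_pow hd0 _)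
        _ = (K * n) ^ d := (mul_pow ..).symm
    exact (Nat.pow_le_pow_iff_left hd0).1 h1
  obtain ⟨s, hs1, hsn, hsm, hs0⟩ := exists_side_length hn hm1
  obtain ⟨σ, hσ⟩ := exists_catchesBy_grid (d := d) (n := s) hd hs1
  obtain ⟨τ, hτ⟩ := exists_catchesBy_of_boxes (c := c) (by omega) hs1 hm1 hsn hsm hmk hσ
  refine ⟨_, m, captureTime_le hτ.copsWinWithin, hm1, hk1, ?_⟩
  rw [← hc]
  -- The two extra rounds are absorbed by `2 * s`, as `s ≥ 1`.
  calc (c * ((2 * d + 6) * s) + 1 + 1) * m ≤ (c * (2 * d + 6) + 2) * s * m := by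
        refine Nat.mul_le_mul_right _ ?_
        rw [show (c * (2 * d + 6) + 2) * s = c * ((2 * d + 6) * s) + 2 * s by ring]
        omega
    _ ≤ (c * (2 * d + 6) + 2) * ((1 + K) * n) := by
        rw [mul_assoc, add_mul 1 K, one_mul]
        exact Nat.mul_le_mul_left _ (by omega)

lemma rpow_le_of_le_pow {x y : ℝ} (hd : d ≠ 0) (hx : 0 ≤ x) (hy : 0 ≤ y) (h : y ≤ x ^ d) :
    y ^ (1 / (d : ℝ)) ≤ x := by
  rw [one_div]
  conv_rhs => rw [← Real.pow_rpow_inv_natCast hx hd]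
  exact Real.rpow_le_rpow hy h (by positivity)

theorem captureTime_grid_upper (hd : 1 ≤ d) (hn : 1 ≤ n) (hk : d < 2 * k) {K : ℕ}
    (hkn : k ≤ K * n ^ d) : captureTime (grid d n) k ≠ ⊤ ∧
      ((captureTime (grid d n) k).toNat : ℝ) ≤
        (((d / 2 + 1) * (2 * d + 6) + 2) * (1 + K) * (2 * (d / 2 + 1)) : ℕ) *
          ((n : ℝ) / (k : ℝ) ^ (1 / (d : ℝ))) := by
  obtain ⟨T, m, hT, hm, hkm, hTm⟩ := exists_captureTime_grid_le hd hn hk hkn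
  refine ⟨ne_top_of_le_ne_top (ENat.natCast_ne_top T) hT, ?_⟩
  have hk0 : (0 : ℝ) < (k : ℝ) ^ (1 / (d : ℝ)) := Real.rpow_pos_of_pos (by norm_cast; omega) _
  have hroot : (k : ℝ) ^ (1 / (d : ℝ)) ≤ ((2 * (d / 2 + 1) * m : ℕ) : ℝ) :=
    rpow_le_of_le_pow (by omega) (by positivity) (by positivity) (by exact_mod_cast hkm)
  refine le_trans (Nat.cast_le.2 (ENat.toNat_le_of_le_natCast hT)) ?_
  rw [← mul_div_assoc, le_div_iff₀ hk0]
  refine (mul_le_mul_of_nonneg_left hroot (by positivity)).trans ?_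
  norm_cast
  calc T * (2 * (d / 2 + 1) * m) = T * m * (2 * (d / 2 + 1)) := by ring
    _ ≤ ((d / 2 + 1) * (2 * d + 6) + 2) * ((1 + K) * n) * (2 * (d / 2 + 1)) :=
      Nat.mul_le_mul_right _ hTm
    _ = _ := by ring

theorem captureTime_grid_lower (hd : 1 ≤ d) (hk0 : 1 ≤ k) (hk : k < n ^ d)
    (hfin : captureTime (grid d n) k ≠ ⊤) :
    (n : ℝ) / (k : ℝ) ^ (1 / (d : ℝ)) ≤ 3 * ((captureTime (grid d n) k).toNat : ℝ) := by
  have h := pow_le_of_copsWinWithin (copsWinWithin_toNat_captureTime hfin)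
  set T := (captureTime (grid d n) k).toNat
  -- With fewer cops than vertices, round 0 is not enough; hence `2 * T + 1 ≤ 3 * T`, the source of
  -- the constant 3.
  have hT : 1 ≤ T := by
    by_contra! hT
    obtain hT0 : T = 0 := by omega
    rw [hT0] at h
    simp at h
    omega
  have hkpos : (0 : ℝ) < k := by norm_cast
  have hroot : (0 : ℝ) < (k : ℝ) ^ (1 / (d : ℝ)) := Real.rpow_pos_of_pos hkpos _
  rw [div_le_iff₀ hroot]
  have h3 : (n : ℝ) ^ d ≤ (3 * (T : ℝ) * (k : ℝ) ^ (1 / (d : ℝ))) ^ d := by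
    rw [mul_pow, one_div, Real.rpow_inv_natCast_pow hkpos.le (by omega), mul_comm]
    have h4 : n ^ d ≤ k * (3 * T) ^ d :=
      h.trans (Nat.mul_le_mul_left _ (Nat.pow_le_pow_left (by omega) _))
    exact_mod_cast h4
  exact (pow_le_pow_iff_left₀ (by positivity) (by positivity) (by omega)).1 h3

end Asymptotics

end CopsRobbers

theorem mainTheorem2 (d : ℕ) (hd : 1 ≤ d) (k : ℕ → ℕ)
    (hcop : ∀ᶠ n : ℕ in atTop, CopsRobbers.copNumber (CopsRobbers.grid d n) ≤ (k n : ℕ∞))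
    (hk : (fun n : ℕ => (k n : ℝ)) =O[atTop] (fun n : ℕ => (n : ℝ) ^ d)) :
    (∀ᶠ n : ℕ in atTop, CopsRobbers.captureTime (CopsRobbers.grid d n) (k n) ≠ ⊤) ∧
    (fun n : ℕ => ((CopsRobbers.captureTime (CopsRobbers.grid d n) (k n)).toNat : ℝ))
      =O[atTop] (fun n : ℕ => (n : ℝ) / (k n : ℝ) ^ (1 / (d : ℝ))) ∧
    ((∀ᶠ n : ℕ in atTop, k n < n ^ d) →
      (fun n : ℕ => ((CopsRobbers.captureTime (CopsRobbers.grid d n) (k n)).toNat : ℝ))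
        =Θ[atTop] (fun n : ℕ => (n : ℝ) / (k n : ℝ) ^ (1 / (d : ℝ)))) := by
  obtain ⟨C, hC⟩ := hk.bound
  obtain ⟨K, hK⟩ := exists_nat_ge C
  have hcops : ∀ᶠ n : ℕ in atTop, d < 2 * k n := by
    filter_upwards [hcop, eventually_gt_atTop (3 * d)] with n h hn
    exact CopsRobbers.lt_two_mul_of_copNumber_le hd hn h
  have hbd : ∀ᶠ n : ℕ in atTop, k n ≤ K * n ^ d := by
    filter_upwards [hC] with n hCn
    rw [Real.norm_of_nonneg (by positivity), Real.norm_of_nonneg (by positivity)] at hCn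
    exact_mod_cast hCn.trans (mul_le_mul_of_nonneg_right hK (by positivity))
  -- Finiteness accompanies the bound because `toNat` sends `⊤` to 0.
  obtain ⟨A, hup⟩ : ∃ A : ℝ, ∀ᶠ n : ℕ in atTop,
      CopsRobbers.captureTime (CopsRobbers.grid d n) (k n) ≠ ⊤ ∧
      ((CopsRobbers.captureTime (CopsRobbers.grid d n) (k n)).toNat : ℝ) ≤
        A * ((n : ℝ) / (k n : ℝ) ^ (1 / (d : ℝ))) :=
    ⟨_, (hbd.and (hcops.and (eventually_ge_atTop 1))).mono fun n h =>
      CopsRobbers.captureTime_grid_upper hd h.2.2 h.2.1 h.1⟩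
  have hO : (fun n : ℕ => ((CopsRobbers.captureTime (CopsRobbers.grid d n) (k n)).toNat : ℝ))
      =O[atTop] (fun n : ℕ => (n : ℝ) / (k n : ℝ) ^ (1 / (d : ℝ))) := by
    refine IsBigO.of_bound A (hup.mono fun n h => ?_)
    rw [Real.norm_of_nonneg (by positivity), Real.norm_of_nonneg (by positivity)]
    exact h.2
  refine ⟨hup.mono fun n h => h.1, hO, fun hlt => ⟨hO, ?_⟩⟩
  refine IsBigO.of_bound 3 ?_
  filter_upwards [hup, hcops, hlt] with n h hkn hn
  rw [Real.norm_of_nonneg (by positivity), Real.norm_of_nonneg (by positivity)]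
  exact CopsRobbers.captureTime_grid_lower hd (by omega) hn h.1
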